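/- For a non-empty finite subset $A$ of an abelian group, let $A+A=\{a+a' : a,a'\in A\}$ and let $\sigma(A)=|A+A|/|A|$ be its doubling constant. For a real number $K$, let $G(K)$ be the least positive integer $g$ with the following property: for every positive integer $m$ and every non-empty set $A\subseteq\mathbb{F}_2^m$ with $\sigma(A)\le K$, there is a linear subspace $V\subseteq\mathbb{F}_2^m$ with $|V|\le|A|$ such that $A$ is covered by at most $g$ translates of $V$. Then \[ G(K)=\begin{cases}2, & 1<K\le\frac74,\\[2pt] 3, & \frac74<K\le\frac{31}{16},\\[2pt] 4, & \frac{31}{16}<K<2.\end{cases} \] -/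

import Mathlib

open scoped Pointwise

/-- The set `A` has a covering by at most `g` translates of a single linear subspace `V`
of `𝔽₂ᵐ` with `|V| ≤ |A|`.  The translates are `t + V` for `t` in a finite set `T`. -/
def IsCoveredByTranslates {m : ℕ} (A : Finset (Fin m → ZMod 2)) (g : ℕ) : Prop :=
  ∃ V : Submodule (ZMod 2) (Fin m → ZMod 2), Nat.card V ≤ A.card ∧
    ∃ T : Finset (Fin m → ZMod 2), T.card ≤ g ∧
      (A : Set (Fin m → ZMod 2)) ⊆ ⋃ t ∈ T, t +ᵥ (V : Set (Fin m → ZMod 2))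

/-- The set of positive integers `g` such that, for every positive `m`, every nonempty
`A ⊆ 𝔽₂ᵐ` with doubling constant `|A + A| / |A| ≤ K` is covered by at most `g` translates of a
subspace of cardinality at most `|A|`. -/
def coveringBounds (K : ℝ) : Set ℕ :=
  {g | 0 < g ∧ ∀ m : ℕ, 0 < m → ∀ A : Finset (Fin m → ZMod 2), A.Nonempty →
    ((A.addConst A : ℚ≥0) : ℝ) ≤ K → IsCoveredByTranslates A g}

/-- `G(K)`, the least element of `coveringBounds K`. (The value would be `0` if that set were
empty, so a positive value of `G K` is always attained by the minimum.) -/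
noncomputable def G (K : ℝ) : ℕ := sInf (coveringBounds K)

/-!
Let `A ⊆ 𝔽₂ᵐ` contain `0` and satisfy `|A + A| < 2|A|`, let `W` be its span and `H` the stabilizer
of `A + A`. The key fact is that `A + A` is either `W` or `W` with a single coset of `H` removed
(`Finset.card_span_le_card_add_self`). Suppose that more is missing, and use the isoperimetric
method of Hamidoune: among the unions `X` of cosets of `H` for which neither `X` nor `W \ (X + B)`
is too small, where `B = A + H`, take one with `|X + B| - |X|` minimal and then `|X|` minimal. Two
translates of this `X` that share more than one coset of `H` are equal, by submodularity. In
characteristic two the translates `X` and `X + (u + v)` share both `u` and `v` for `u, v ∈ X`, so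
`X` is a coset of a subspace `V` (`Finset.exists_submodule_boundary_le`). Its boundary is so small
that `B` nearly fills all its cosets of `V`, so `A + A` is a union of cosets of `V`
(`Finset.le_stab_add_self`), contradicting the choice of `H`.

If `A + A = W`, or if `2|A| = |W|`, then two cosets of a hyperplane of `W` cover `A`. Otherwise
`|W| = 2 ^ r |H|`, the set `B` is a union of half of the cosets of `H` in `W`, and the doubling of
`A` exceeds `2 - 2 / 2 ^ r`. Four cosets of a subspace of index four always suffice. Doubling at
most `7/4` forces `r = 2`, where two cosets of `H` suffice, and doubling at most `31/16` forces
`r ≤ 4`. In that case `B` contains a coset of a subspace of index four: for `r = 4` it consists of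
eight cosets of `H`, and two different pairs of these have the same sum
(`Finset.exists_coset_subset`). A translate of that coset avoids `A`, so three cosets suffice.

For the lower bounds, consider all nonzero vectors, and the nonzero zeros of `z₀z₁ + z₂` and
`z₀z₁ + z₂z₃ + z₄` in large dimension. Their doublings tend to `1`, `7/4` and `31/16`. A cover by too
few translates of `V` leaves free a coset of a subspace on which the quadratic function is `1`
except perhaps at one point, and that subspace together with the radical direction of the linear
term would be an isotropic subspace of too large a dimension (`isotropic_of_coset_disjoint`).
-/

/-! ### Counting in finite vector spaces over `𝔽₂` -/

section SubspaceCounting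

variable {E : Type*} [AddCommGroup E] [Module (ZMod 2) E]

theorem ZModModule.add_add_cancel_right (x y : E) : x + y + y = x := by
  rw [add_assoc, ZModModule.add_self, add_zero]

theorem ZModModule.add_add_cancel_left (x y : E) : x + (x + y) = y := by
  rw [← add_assoc, ZModModule.add_self, zero_add]

theorem Submodule.mkQ_eq_iff {V : Submodule (ZMod 2) E} {x y : E} :
    V.mkQ x = V.mkQ y ↔ x + y ∈ V := by
  rw [mkQ_apply, mkQ_apply, Quotient.eq, ZModModule.sub_eq_add]

theorem Submodule.mem_sup_span_singleton {V : Submodule (ZMod 2) E} {x y : E} :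
    y ∈ V ⊔ span (ZMod 2) {x} ↔ y ∈ V ∨ y + x ∈ V := by
  constructor
  · intro h
    obtain ⟨v, hv, z, hz, rfl⟩ := mem_sup.1 h
    obtain ⟨c, rfl⟩ := mem_span_singleton.1 hz
    have hc : ∀ c : ZMod 2, c = 0 ∨ c = 1 := by decide
    obtain rfl | rfl := hc c
    · left; simpa using hv
    · right; rwa [one_smul, ZModModule.add_add_cancel_right]
  · rintro (h | h)
    · exact mem_sup_left h
    · rw [← ZModModule.add_add_cancel_right y x]
      exact add_mem (mem_sup_left h) (mem_sup_right (mem_span_singleton_self x))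

variable [Fintype E]

/-- The finite set of elements of a subspace of a finite `𝔽₂`-vector space. -/
noncomputable def Submodule.points (V : Submodule (ZMod 2) E) : Finset E :=
  (V : Set E).toFinite.toFinset

namespace Submodule

@[simp]
theorem mem_points {V : Submodule (ZMod 2) E} {x : E} : x ∈ V.points ↔ x ∈ V := by
  simp [points]

theorem card_points (V : Submodule (ZMod 2) E) : V.points.card = Nat.card V := by
  rw [points, ← Set.ncard_eq_toFinset_card, ← Nat.card_coe_set_eq]
  rfl

theorem card_points_pos (V : Submodule (ZMod 2) E) : 0 < V.points.card :=
  Finset.card_pos.2 ⟨0, by simp⟩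

theorem card_points_eq_two_pow (V : Submodule (ZMod 2) E) : ∃ d : ℕ, V.points.card = 2 ^ d :=
  ⟨Module.finrank (ZMod 2) V, by
    rw [card_points, Module.natCard_eq_pow_finrank (K := ZMod 2), Nat.card_zmod]⟩

theorem points_subset {V W : Submodule (ZMod 2) E} (h : V ≤ W) : V.points ⊆ W.points :=
  fun x hx => by simp only [mem_points] at hx ⊢; exact h hx

theorem card_points_eq_two_pow_mul {V W : Submodule (ZMod 2) E} (h : V ≤ W) :
    ∃ r : ℕ, W.points.card = 2 ^ r * V.points.card := by
  obtain ⟨a, ha⟩ := V.card_points_eq_two_pow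
  obtain ⟨b, hb⟩ := W.card_points_eq_two_pow
  have hab : a ≤ b := by
    have := Finset.card_le_card (points_subset h)
    rw [ha, hb] at this
    exact (Nat.pow_le_pow_iff_right (by norm_num)).1 this
  exact ⟨b - a, by rw [ha, hb, ← pow_add, Nat.sub_add_cancel hab]⟩

/-- Every nonzero subspace over `𝔽₂` has a subspace of half its size. -/
theorem exists_le_two_mul_card {W : Submodule (ZMod 2) E} (hW : 1 < W.points.card) :
    ∃ V ≤ W, 2 * V.points.card = W.points.card := by
  obtain ⟨V, hV1, hV2, hVW⟩ := ZModModule.exists_submodule_subset_card_le Nat.prime_two W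
    (k := W.points.card / 2) (by rw [← card_points]; omega) (by omega)
  rw [← card_points] at hV1 hV2
  refine ⟨V, hVW, ?_⟩
  obtain ⟨r, hr⟩ := card_points_eq_two_pow_mul hVW
  have hpos := V.card_points_pos
  rw [hr] at hV1 hV2 ⊢
  rcases r with _ | _ | r
  · omega
  · omega
  · have h1 : 0 < 2 ^ r := by positivity
    have : 2 ^ (r + 1 + 1) * V.points.card / 2 = 2 ^ (r + 1) * V.points.card := by
      rw [pow_succ, mul_right_comm, Nat.mul_div_cancel _ (by norm_num)]
    rw [this, pow_succ] at hV2
    nlinarith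

variable [DecidableEq E]

theorem points_sup_span_singleton (V : Submodule (ZMod 2) E) (x : E) :
    (V ⊔ span (ZMod 2) {x}).points = V.points ∪ (V.points + {x}) := by
  ext y
  simp only [mem_points, mem_sup_span_singleton, Finset.mem_union, Finset.mem_add,
    Finset.mem_singleton, exists_eq_left]
  refine or_congr_right ⟨fun h => ⟨_, h, ZModModule.add_add_cancel_right y x⟩, ?_⟩
  rintro ⟨v, hv, rfl⟩
  rwa [ZModModule.add_add_cancel_right]

theorem card_points_sup_span_singleton {V : Submodule (ZMod 2) E} {x : E} (hx : x ∉ V) :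
    (V ⊔ span (ZMod 2) {x}).points.card = 2 * V.points.card := by
  rw [points_sup_span_singleton, two_mul, Finset.card_union_of_disjoint,
    Finset.card_add_singleton]
  rw [Finset.disjoint_left]
  intro y hy hy'
  simp only [mem_points, Finset.mem_add, Finset.mem_singleton, exists_eq_left] at hy hy'
  obtain ⟨v, hv, rfl⟩ := hy'
  exact hx ((V.add_mem_iff_right hv).1 hy)

/-- The sumset of `A` with a subspace `V` is the union of the cosets of `V` that meet `A`. -/
theorem card_add_points (A : Finset E) (V : Submodule (ZMod 2) E) [DecidableEq (E ⧸ V)] :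
    (A + V.points).card = (A.image V.mkQ).card * V.points.card := by
  rw [Finset.card_eq_sum_card_fiberwise (f := V.mkQ) (t := A.image V.mkQ),
    Finset.sum_const_nat]
  · intro q hq
    obtain ⟨a, ha, rfl⟩ := Finset.mem_image.1 hq
    rw [← Finset.card_add_singleton V.points a]
    congr 1
    ext y
    simp only [Finset.mem_filter, Finset.mem_add, Finset.mem_singleton, exists_eq_left,
      mem_points, mkQ_eq_iff]
    constructor
    · rintro ⟨-, h⟩
      exact ⟨_, h, ZModModule.add_add_cancel_right y a⟩
    · rintro ⟨v, hv, rfl⟩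
      rw [ZModModule.add_add_cancel_right]
      exact ⟨⟨a, ha, v, hv, add_comm _ _⟩, hv⟩
  · intro y hy
    obtain ⟨a, ha, v, hv, rfl⟩ := Finset.mem_add.1 hy
    refine Finset.mem_coe.2 (Finset.mem_image.2 ⟨a, ha, mkQ_eq_iff.2 ?_⟩)
    rw [ZModModule.add_add_cancel_left]
    exact mem_points.1 hv

theorem card_points_dvd_card {V : Submodule (ZMod 2) E} {X : Finset E}
    (hX : ∀ x ∈ X, ∀ v ∈ V, x + v ∈ X) : V.points.card ∣ X.card := by
  classical
  have h : X + V.points = X := by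
    refine Finset.Subset.antisymm ?_ fun x hx => ?_
    · intro y hy
      obtain ⟨x, hx, v, hv, rfl⟩ := Finset.mem_add.1 hy
      exact hX x hx v (mem_points.1 hv)
    · exact Finset.mem_add.2 ⟨x, hx, 0, by simp, add_zero x⟩
  rw [← h, card_add_points]
  exact Dvd.intro_left _ rfl

/-- Two subsets of cosets of `V` with more than `|V|` elements together have a sumset that
fills a coset of `V`. -/
theorem add_mem_of_card_lt {V : Submodule (ZMod 2) E} {X Y : Finset E} {a b : E}
    (hX : ∀ x ∈ X, x + a ∈ V) (hY : ∀ y ∈ Y, y + b ∈ V) (hXY : V.points.card < X.card + Y.card)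
    {v : E} (hv : v ∈ V) : a + b + v ∈ X + Y := by
  by_contra hcon
  have hdisj : Disjoint (X + {a}) (Y + {b + v}) := by
    rw [Finset.disjoint_left]
    intro z hz hz'
    obtain ⟨x, hx, _, ha, rfl⟩ := Finset.mem_add.1 hz
    obtain ⟨y, hy, _, hb, h⟩ := Finset.mem_add.1 hz'
    rw [Finset.mem_singleton] at ha hb
    subst ha hb
    refine hcon (Finset.mem_add.2 ⟨x, hx, y, hy, ?_⟩)
    rename_i a
    have e1 : y = x + a + (b + v) := by rw [← h, ZModModule.add_add_cancel_right]
    rw [e1, ← add_assoc, ← add_assoc, ← add_assoc, ZModModule.add_self, zero_add]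
  have hsub : (X + {a}) ∪ (Y + {b + v}) ⊆ V.points := by
    intro z hz
    rw [mem_points]
    rcases Finset.mem_union.1 hz with hz | hz
    · obtain ⟨x, hx, _, ha, rfl⟩ := Finset.mem_add.1 hz
      rw [Finset.mem_singleton.1 ha]
      exact hX x hx
    · obtain ⟨y, hy, _, hb, rfl⟩ := Finset.mem_add.1 hz
      rw [Finset.mem_singleton.1 hb, ← add_assoc]
      exact V.add_mem (hY y hy) hv
  have := Finset.card_le_card hsub
  rw [Finset.card_union_of_disjoint hdisj, Finset.card_add_singleton,
    Finset.card_add_singleton] at this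
  omega

end Submodule

end SubspaceCounting

/-! ### Sets with doubling less than two -/

section SmallDoubling

variable {E : Type*} [AddCommGroup E] [Module (ZMod 2) E]

/-- The subspace of all translations that map the finite set `S` into itself. -/
def Finset.stab (S : Finset E) : Submodule (ZMod 2) E :=
  AddSubgroup.toZModSubmodule 2
    { carrier := {k | ∀ s ∈ S, s + k ∈ S}
      zero_mem' := fun s hs => by rwa [add_zero]
      add_mem' := fun {k l} hk hl s hs => by rw [← add_assoc]; exact hl _ (hk s hs)
      neg_mem' := fun {k} hk s hs => by rw [ZModModule.neg_eq_self]; exact hk s hs }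

theorem Finset.mem_stab {S : Finset E} {k : E} : k ∈ S.stab ↔ ∀ s ∈ S, s + k ∈ S := Iff.rfl

theorem Finset.add_singleton_mem_iff [DecidableEq E] {X : Finset E} {x y : E} :
    x ∈ X + {y} ↔ x + y ∈ X := by
  simp only [Finset.mem_add, Finset.mem_singleton, exists_eq_left]
  constructor
  · rintro ⟨z, hz, rfl⟩
    rwa [ZModModule.add_add_cancel_right]
  · intro h
    exact ⟨_, h, ZModModule.add_add_cancel_right x y⟩

variable [Fintype E] [DecidableEq E]

/-- The sets `X` competing in the isoperimetric problem for `B` inside `W`: unions of cosets of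
`H` such that neither `X` nor the complement of `X + B` in `W` is a single coset or empty. -/
def Finset.IsAdmissible (W H : Submodule (ZMod 2) E) (X B : Finset E) : Prop :=
  X ⊆ W.points ∧ (∀ x ∈ X, ∀ v ∈ H, x + v ∈ X) ∧ H.points.card < X.card ∧
    H.points.card + (X + B).card < W.points.card

theorem Finset.add_subset_points {W : Submodule (ZMod 2) E} {X Y : Finset E}
    (hX : X ⊆ W.points) (hY : Y ⊆ W.points) : X + Y ⊆ W.points := by
  intro z hz
  obtain ⟨x, hx, y, hy, rfl⟩ := Finset.mem_add.1 hz
  exact Submodule.mem_points.2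
    (W.add_mem (Submodule.mem_points.1 (hX hx)) (Submodule.mem_points.1 (hY hy)))

/-- The complement of `X + B` inside `W` is again admissible, and it has at most the same
boundary as `X`, because adding `B` to it avoids `X` in characteristic two. -/
theorem Finset.IsAdmissible.dual {W H : Submodule (ZMod 2) E} {B X : Finset E}
    (hHW : H ≤ W) (hBW : B ⊆ W.points) (hX : X.IsAdmissible W H B) :
    (W.points \ (X + B)).IsAdmissible W H B ∧
      (W.points \ (X + B) + B).card + X.card ≤ W.points.card := by
  obtain ⟨hXW, hper, hcard, hcompl⟩ := hX
  have hXB : X + B ⊆ W.points := Finset.add_subset_points hXW hBW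
  have hdisj : Disjoint (W.points \ (X + B) + B) X := by
    rw [Finset.disjoint_left]
    intro z hz hzX
    obtain ⟨y, hy, b, hb, rfl⟩ := Finset.mem_add.1 hz
    refine (Finset.mem_sdiff.1 hy).2 (Finset.mem_add.2 ⟨_, hzX, b, hb, ?_⟩)
    exact ZModModule.add_add_cancel_right y b
  have hle : (W.points \ (X + B) + B).card + X.card ≤ W.points.card := by
    rw [← Finset.card_union_of_disjoint hdisj]
    exact Finset.card_le_card
      (Finset.union_subset (Finset.add_subset_points Finset.sdiff_subset hBW) hXW)
  refine ⟨⟨Finset.sdiff_subset, ?_, ?_, by omega⟩, hle⟩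
  · intro x hx v hv
    obtain ⟨hxW, hxn⟩ := Finset.mem_sdiff.1 hx
    refine Finset.mem_sdiff.2 ⟨?_, fun h => hxn ?_⟩
    · rw [Submodule.mem_points] at hxW ⊢
      exact W.add_mem hxW (hHW hv)
    · obtain ⟨y, hy, b, hb, h⟩ := Finset.mem_add.1 h
      refine Finset.mem_add.2 ⟨y + v, hper y hy v hv, b, hb, ?_⟩
      rw [add_right_comm, h, ZModModule.add_add_cancel_right]
  · rw [Finset.card_sdiff_of_subset hXB]
    omega

/-- A set that is carried to itself by all its differences is a coset of a subspace. -/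
theorem Finset.exists_submodule_of_translation {M : Finset E}
    (hM : ∀ u ∈ M, ∀ v ∈ M, ∀ w ∈ M, w + (u + v) ∈ M) {u₀ : E} (hu₀ : u₀ ∈ M) :
    ∃ V : Submodule (ZMod 2) E, V.points = M + {u₀} := by
  refine ⟨AddSubgroup.toZModSubmodule 2
    { carrier := {x | x + u₀ ∈ M}
      zero_mem' := by simpa using hu₀
      add_mem' := ?_
      neg_mem' := fun {k} hk => by rw [ZModModule.neg_eq_self]; exact hk }, ?_⟩
  · intro x y hx hy
    have := hM _ hx _ hu₀ _ hy
    rw [ZModModule.add_add_cancel_right, add_right_comm, add_comm y x] at this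
    exact this
  · ext x
    rw [Submodule.mem_points, Finset.add_singleton_mem_iff]
    rfl

/-- The isoperimetric argument: among admissible sets with the smallest boundary, one of the
smallest size is a coset of a subspace. Otherwise it would meet one of its translates in a smaller
admissible set, which by submodularity has a boundary that is no larger. -/
theorem Finset.exists_submodule_boundary_le {W H : Submodule (ZMod 2) E} {B : Finset E}
    (hHW : H ≤ W) (hB : B.IsAdmissible W H B) :
    ∃ V : Submodule (ZMod 2) E, H < V ∧ V ≤ W ∧
      (V.points + B).card + B.card ≤ (B + B).card + V.points.card ∧
      (V.points + B).card < W.points.card := by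
  classical
  have hBW := hB.1
  let cost : Finset E → ℤ := fun X => (X + B).card - X.card
  obtain ⟨M, hM, hmin⟩ := Finset.exists_min_image
    (W.points.powerset.filter (fun X => X.IsAdmissible W H B))
    (fun X => toLex (cost X, X.card))
    ⟨B, Finset.mem_filter.2 ⟨Finset.mem_powerset.2 hBW, hB⟩⟩
  have hM := (Finset.mem_filter.1 hM).2
  have hmin : ∀ X : Finset E, X.IsAdmissible W H B →
      cost M < cost X ∨ cost M = cost X ∧ M.card ≤ X.card := by
    intro X hX
    have := hmin X (Finset.mem_filter.2 ⟨Finset.mem_powerset.2 hX.1, hX⟩)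
    rwa [Prod.Lex.toLex_le_toLex] at this
  have hcost : ∀ X : Finset E, X.IsAdmissible W H B → cost M ≤ cost X := by
    intro X hX
    rcases hmin X hX with h | h
    · exact h.le
    · exact h.1.le
  have hcard : ∀ X : Finset E, X.IsAdmissible W H B → cost X ≤ cost M → M.card ≤ X.card := by
    intro X hX hle
    rcases hmin X hX with h | h
    · omega
    · exact h.2
  obtain ⟨hMW, hMper, hMcard, hMcompl⟩ := id hM
  have hMB : M + B ⊆ W.points := Finset.add_subset_points hMW hBW
  have hdual : M.card + (M + B).card ≤ W.points.card := by
    obtain ⟨hD, hDle⟩ := hM.dual hHW hBW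
    have hDc : (W.points \ (M + B)).card + (M + B).card = W.points.card :=
      Finset.card_sdiff_add_card_eq_card hMB
    have := hcard _ hD (by simp only [cost]; omega)
    omega
  have htrans : ∀ u ∈ M, ∀ v ∈ M, ∀ w ∈ M, w + (u + v) ∈ M := by
    intro u hu v hv w hw
    by_cases huv : u + v ∈ H
    · exact hMper w hw _ huv
    have huvW : u + v ∈ W :=
      W.add_mem (Submodule.mem_points.1 (hMW hu)) (Submodule.mem_points.1 (hMW hv))
    set N := M + {u + v} with hN
    have hNW : N ⊆ W.points := Finset.add_subset_points hMW
      (Finset.singleton_subset_iff.2 (Submodule.mem_points.2 huvW))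
    have hNcard : N.card = M.card := Finset.card_add_singleton _ _
    have hNB : (N + B).card = (M + B).card := by
      rw [hN, add_right_comm, Finset.card_add_singleton]
    have hNper : ∀ x ∈ N, ∀ k ∈ H, x + k ∈ N := by
      intro x hx k hk
      rw [Finset.add_singleton_mem_iff] at hx ⊢
      rw [add_right_comm]
      exact hMper _ hx k hk
    -- The intersection contains the two cosets `u + H` and `v + H`.
    have hinter : H.points.card < (M ∩ N).card := by
      have hsub : (H ⊔ Submodule.span (ZMod 2) {u + v}).points + {u} ⊆ M ∩ N := by
        intro z hz
        rw [Finset.add_singleton_mem_iff, Submodule.mem_points,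
          Submodule.mem_sup_span_singleton] at hz
        have key : z ∈ M ∧ z + (u + v) ∈ M := by
          rcases hz with hz | hz
          · refine ⟨?_, ?_⟩
            · have := hMper u hu _ hz
              rwa [add_comm z u, ZModModule.add_add_cancel_left] at this
            · have := hMper v hv _ hz
              rwa [add_comm v, add_assoc] at this
          · refine ⟨?_, ?_⟩
            · have := hMper v hv _ hz
              have e : v + (z + u + (u + v)) = z := by
                rw [add_assoc z, ZModModule.add_add_cancel_left, add_comm,
                  ZModModule.add_add_cancel_right]
              rwa [e] at this
            · have := hMper u hu _ hz
              have e : u + (z + u + (u + v)) = z + (u + v) := by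
                rw [add_assoc z, add_left_comm, ZModModule.add_add_cancel_left]
              rwa [e] at this
        exact Finset.mem_inter.2 ⟨key.1, Finset.add_singleton_mem_iff.2 key.2⟩
      have h1 := Finset.card_le_card hsub
      rw [Finset.card_add_singleton, Submodule.card_points_sup_span_singleton huv] at h1
      have := H.card_points_pos
      omega
    have hsubm : ((M ∩ N) + B).card + ((M ∪ N) + B).card ≤ 2 * (M + B).card := by
      have h1 := Finset.card_le_card (Finset.inter_add_subset (s₁ := M) (s₂ := N) (t := B))
      have h2 := Finset.card_union_add_card_inter (M + B) (N + B)
      rw [← Finset.union_add] at h2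
      omega
    have hmod : (M ∪ N).card + (M ∩ N).card = 2 * M.card := by
      rw [Finset.card_union_add_card_inter, hNcard, two_mul]
    have hinterAdm : (M ∩ N).IsAdmissible W H B := by
      refine ⟨Finset.inter_subset_left.trans hMW, ?_, hinter, ?_⟩
      · intro x hx k hk
        obtain ⟨h1, h2⟩ := Finset.mem_inter.1 hx
        exact Finset.mem_inter.2 ⟨hMper x h1 k hk, hNper x h2 k hk⟩
      · have : ((M ∩ N) + B).card ≤ (M + B).card :=
          Finset.card_le_card (Finset.add_subset_add_right Finset.inter_subset_left)
        omega
    have h1 := hcost _ hinterAdm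
    have hunionAdm : (M ∪ N).IsAdmissible W H B := by
      refine ⟨Finset.union_subset hMW hNW, ?_, ?_, ?_⟩
      · intro x hx k hk
        rcases Finset.mem_union.1 hx with hx | hx
        · exact Finset.mem_union_left _ (hMper x hx k hk)
        · exact Finset.mem_union_right _ (hNper x hx k hk)
      · exact hMcard.trans_le (Finset.card_le_card Finset.subset_union_left)
      · simp only [cost] at h1
        omega
    have h2 := hcost _ hunionAdm
    have h3 := hcard _ hinterAdm (by simp only [cost] at h1 h2 ⊢; omega)
    have h4 : M ∩ N = M := Finset.eq_of_subset_of_card_le Finset.inter_subset_left h3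
    have h5 : w ∈ N := (Finset.mem_inter.1 (h4.symm ▸ hw)).2
    exact Finset.add_singleton_mem_iff.1 h5
  obtain ⟨u₀, hu₀⟩ : M.Nonempty := Finset.card_pos.1 (by omega)
  obtain ⟨V, hV⟩ := Finset.exists_submodule_of_translation htrans hu₀
  have hVM : V.points.card = M.card := by rw [hV, Finset.card_add_singleton]
  have hVB : (V.points + B).card = (M + B).card := by
    rw [hV, add_right_comm, Finset.card_add_singleton]
  have hHV : H ≤ V := by
    intro k hk
    rw [← Submodule.mem_points, hV, Finset.add_singleton_mem_iff, add_comm]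
    exact hMper u₀ hu₀ k hk
  refine ⟨V, lt_of_le_of_ne hHV ?_, ?_, ?_, by omega⟩
  · rintro rfl
    omega
  · intro k hk
    rw [← Submodule.mem_points, hV, Finset.add_singleton_mem_iff] at hk
    exact (W.add_mem_iff_left (Submodule.mem_points.1 (hMW hu₀))).1
      (Submodule.mem_points.1 (hMW hk))
  · have := hcost B hB
    simp only [cost] at this
    omega

/-- If `B` fills its cosets of `V` up to fewer than `|V|` missing points and is not contained in
`V`, then any two parts of `B` in different cosets of `V` add up to a full coset, so that `B + B`
is a union of cosets of `V`. -/
theorem Finset.le_stab_add_self {V : Submodule (ZMod 2) E} {B : Finset E} (h0 : 0 ∈ B)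
    (hBV : (V.points + B).card < B.card + V.points.card) (hgen : ∃ c ∈ B, c ∉ V) :
    V ≤ (B + B).stab := by
  have hpart : ∀ a ∈ B, ∀ b ∈ B, a + b ∉ V → V.points.card <
      (B.filter fun x => x + a ∈ V.points).card + (B.filter fun x => x + b ∈ V.points).card := by
    intro a ha b hb hab
    have hdisj : ∀ X Y : Finset E, (∀ x ∈ X, x + a ∈ V) → (∀ y ∈ Y, y + b ∈ V) → Disjoint X Y := by
      intro X Y hX hY
      rw [Finset.disjoint_left]
      intro x hx hy
      have := V.add_mem (hX x hx) (hY x hy)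
      rw [add_comm x a, add_assoc, ZModModule.add_add_cancel_left] at this
      exact hab this
    have hcos : ∀ a ∈ B, ∀ x ∈ V.points + {a}, x ∈ V.points + B ∧ x + a ∈ V := by
      intro a ha x hx
      refine ⟨Finset.add_subset_add_left (Finset.singleton_subset_iff.2 ha) hx, ?_⟩
      exact Submodule.mem_points.1 (Finset.add_singleton_mem_iff.1 hx)
    -- The points of `V + B` missing from `B` outnumber those missing in the two cosets.
    set X := B.filter fun x => x + a ∈ V.points
    set Y := B.filter fun x => x + b ∈ V.points
    set P := V.points + {a}
    set Q := V.points + {b}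
    have hXV : ∀ x ∈ X, x + a ∈ V := fun x hx => Submodule.mem_points.1 (Finset.mem_filter.1 hx).2
    have hYV : ∀ x ∈ Y, x + b ∈ V := fun x hx => Submodule.mem_points.1 (Finset.mem_filter.1 hx).2
    have hPc : P.card = V.points.card := Finset.card_add_singleton _ _
    have hQc : Q.card = V.points.card := Finset.card_add_singleton _ _
    have hPQ : Disjoint P Q := hdisj P Q (fun x hx => (hcos a ha x hx).2)
      (fun x hx => (hcos b hb x hx).2)
    have hXY : Disjoint X Y := hdisj X Y hXV hYV
    have hsub : P ∪ Q ∪ (B \ (X ∪ Y)) ⊆ V.points + B := by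
      refine Finset.union_subset (Finset.union_subset (fun x hx => (hcos a ha x hx).1)
        (fun x hx => (hcos b hb x hx).1)) fun x hx => ?_
      exact Finset.mem_add.2 ⟨0, by simp, x, (Finset.mem_sdiff.1 hx).1, zero_add x⟩
    have hd : Disjoint (P ∪ Q) (B \ (X ∪ Y)) := by
      rw [Finset.disjoint_left]
      intro x hx hx'
      obtain ⟨hxB, hn⟩ := Finset.mem_sdiff.1 hx'
      refine hn (Finset.mem_union.2 ((Finset.mem_union.1 hx).imp (fun h => ?_) fun h => ?_))
      · exact Finset.mem_filter.2 ⟨hxB, Finset.add_singleton_mem_iff.1 h⟩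
      · exact Finset.mem_filter.2 ⟨hxB, Finset.add_singleton_mem_iff.1 h⟩
    have h1 := Finset.card_le_card hsub
    rw [Finset.card_union_of_disjoint hd, Finset.card_union_of_disjoint hPQ] at h1
    have h2 := Finset.card_sdiff_add_card_eq_card
      (Finset.union_subset (Finset.filter_subset _ _) (Finset.filter_subset _ _) : X ∪ Y ⊆ B)
    rw [Finset.card_union_of_disjoint hXY] at h2
    omega
  have hfill : ∀ a b k : E, k ∈ V → V.points.card <
      (B.filter fun x => x + a ∈ V.points).card + (B.filter fun x => x + b ∈ V.points).card →
      a + b + k ∈ B + B := by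
    intro a b k hk h
    refine Finset.add_subset_add (Finset.filter_subset _ _) (Finset.filter_subset _ _)
      (Submodule.add_mem_of_card_lt ?_ ?_ h hk)
    · exact fun x hx => Submodule.mem_points.1 (Finset.mem_filter.1 hx).2
    · exact fun x hx => Submodule.mem_points.1 (Finset.mem_filter.1 hx).2
  intro k hk
  rw [Finset.mem_stab]
  intro s hs
  obtain ⟨a, ha, b, hb, rfl⟩ := Finset.mem_add.1 hs
  by_cases hab : a + b ∈ V
  · -- One of two different cosets is more than half filled by `B`, and yields all of `V`.
    obtain ⟨c, hc, hcV⟩ := hgen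
    have h := hpart 0 h0 c hc (by rwa [zero_add])
    have hk' : a + b + k ∈ V := V.add_mem hab hk
    rcases le_total (B.filter fun x => x + 0 ∈ V.points).card
      (B.filter fun x => x + c ∈ V.points).card with hle | hle
    · have := hfill c c _ hk' (by omega)
      rwa [ZModModule.add_self, zero_add] at this
    · have := hfill 0 0 _ hk' (by omega)
      rwa [ZModModule.add_self, zero_add] at this
  · exact hfill a b k hk (hpart a ha b hb hab)

/-- **Structure of sets with doubling less than two.** If `|A + A| < 2|A|` and `0 ∈ A`, then at
most one coset of the stabilizer of `A + A` is missing from `A + A` in the span of `A`. -/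
theorem Finset.card_span_le_card_add_self {A : Finset E} (h0 : 0 ∈ A)
    (hA : (A + A).card < 2 * A.card) :
    (Submodule.span (ZMod 2) (A : Set E)).points.card ≤
      (A + A).card + (A + A).stab.points.card := by
  by_contra hcon
  push Not at hcon
  set W := Submodule.span (ZMod 2) (A : Set E) with hW
  set S := A + A with hS
  set H := S.stab with hH
  have hAW : A ⊆ W.points := fun a ha => Submodule.mem_points.2 (Submodule.subset_span ha)
  have h0S : 0 ∈ S := Finset.mem_add.2 ⟨0, h0, 0, h0, add_zero 0⟩
  have hHS : H.points ⊆ S := by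
    intro k hk
    have := Finset.mem_stab.1 (Submodule.mem_points.1 hk) 0 h0S
    rwa [zero_add] at this
  have hHW : H ≤ W := fun k hk => Submodule.mem_points.1
    (Finset.add_subset_points hAW hAW (hHS (Submodule.mem_points.2 hk)))
  -- The union of cosets of `H` that meet `A` has the same sumset.
  set B := A + H.points with hBdef
  have hAB : A ⊆ B := fun a ha => Finset.mem_add.2 ⟨a, ha, 0, by simp, add_zero a⟩
  have hBB : B + B = S := by
    refine Finset.Subset.antisymm ?_ (Finset.add_subset_add hAB hAB)
    intro z hz
    obtain ⟨x, hx, y, hy, rfl⟩ := Finset.mem_add.1 hz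
    obtain ⟨a, ha, k, hk, rfl⟩ := Finset.mem_add.1 hx
    obtain ⟨b, hb, l, hl, rfl⟩ := Finset.mem_add.1 hy
    rw [add_add_add_comm]
    exact Finset.mem_stab.1 (H.add_mem (Submodule.mem_points.1 hk) (Submodule.mem_points.1 hl))
      _ (Finset.mem_add.2 ⟨a, ha, b, hb, rfl⟩)
  have hABc := Finset.card_le_card hAB
  have hnotsub : ∀ V : Submodule (ZMod 2) E, V.points.card < W.points.card → ∃ c ∈ A, c ∉ V := by
    intro V hV
    by_contra h
    push Not at h
    have : W ≤ V := Submodule.span_le.2 fun a ha => h a ha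
    have := Finset.card_le_card (Submodule.points_subset this)
    omega
  have hadm : B.IsAdmissible W H B := by
    refine ⟨Finset.add_subset_points hAW (Submodule.points_subset hHW), ?_, ?_, ?_⟩
    · intro x hx v hv
      obtain ⟨a, ha, k, hk, rfl⟩ := Finset.mem_add.1 hx
      rw [add_assoc]
      exact Finset.mem_add.2 ⟨a, ha, _,
        Submodule.mem_points.2 (H.add_mem (Submodule.mem_points.1 hk) hv), rfl⟩
    · obtain ⟨c, hc, hcH⟩ := hnotsub H (by omega)
      refine Finset.card_lt_card ⟨?_, fun h => hcH (Submodule.mem_points.1 (h (hAB hc)))⟩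
      exact fun k hk => Finset.mem_add.2 ⟨0, h0, k, hk, zero_add k⟩
    · rw [hBB]; omega
  obtain ⟨V, hHV, hVW, hle, hlt⟩ := Finset.exists_submodule_boundary_le hHW hadm
  rw [hBB] at hle
  have hVB : V.points.card ≤ (V.points + B).card :=
    Finset.card_le_card fun v hv => Finset.mem_add.2 ⟨v, hv, 0, hAB h0, add_zero v⟩
  obtain ⟨c, hc, hcV⟩ := hnotsub V (by omega)
  have := Finset.le_stab_add_self (hAB h0) (V := V) (by omega) ⟨c, hAB hc, hcV⟩
  rw [hBB] at this
  exact hHV.not_ge this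

end SmallDoubling

/-! ### Covering sets with doubling less than two -/

section UpperBounds

variable {E : Type*} [AddCommGroup E] [Module (ZMod 2) E] [Fintype E] [DecidableEq E]

/-- A form of the covering property that counts points: `g` translates of `V` suffice to cover `A`
exactly when `|A + V| ≤ g|V|`. -/
def Finset.HasSubspaceCover (A : Finset E) (g : ℕ) : Prop :=
  ∃ V : Submodule (ZMod 2) E, V.points.card ≤ A.card ∧ (A + V.points).card ≤ g * V.points.card

theorem Finset.HasSubspaceCover.mono {A : Finset E} {g g' : ℕ} (h : A.HasSubspaceCover g)
    (hg : g ≤ g') : A.HasSubspaceCover g' := by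
  obtain ⟨V, h1, h2⟩ := h
  exact ⟨V, h1, h2.trans (Nat.mul_le_mul_right _ hg)⟩

theorem Finset.hasSubspaceCover_of_add_singleton {A : Finset E} {a : E} {g : ℕ}
    (h : (A + {a}).HasSubspaceCover g) : A.HasSubspaceCover g := by
  obtain ⟨V, h1, h2⟩ := h
  rw [Finset.card_add_singleton] at h1
  rw [add_right_comm, Finset.card_add_singleton] at h2
  exact ⟨V, h1, h2⟩

/-- The quantitative structure of a set `A` containing `0` with `|A + A| < 2|A|` and
`A + A ≠ span A`: the sumset is the span `W` with one coset of its stabilizer `H` removed, and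
`A` meets half of the cosets of `H` in `W`. -/
theorem Finset.card_of_add_self_ne_span {A : Finset E} (h0 : 0 ∈ A)
    (hA : (A + A).card < 2 * A.card) {x : E}
    (hxW : x ∈ Submodule.span (ZMod 2) (A : Set E)) (hxS : x ∉ A + A) :
    (A + A).stab ≤ Submodule.span (ZMod 2) (A : Set E) ∧
    (A + A).card + (A + A).stab.points.card =
      (Submodule.span (ZMod 2) (A : Set E)).points.card ∧
    2 * (A + (A + A).stab.points).card = (Submodule.span (ZMod 2) (A : Set E)).points.card ∧
    ∃ r, 2 ≤ r ∧ (Submodule.span (ZMod 2) (A : Set E)).points.card =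
      2 ^ r * (A + A).stab.points.card := by
  have hstruct := Finset.card_span_le_card_add_self h0 hA
  set W := Submodule.span (ZMod 2) (A : Set E) with hW
  set S := A + A with hS
  set H := S.stab with hH
  have hAW : A ⊆ W.points := fun a ha => Submodule.mem_points.2 (Submodule.subset_span ha)
  have hSW : S ⊆ W.points := Finset.add_subset_points hAW hAW
  have h0S : 0 ∈ S := Finset.mem_add.2 ⟨0, h0, 0, h0, add_zero 0⟩
  have hHS : H.points ⊆ S := by
    intro k hk
    have := Finset.mem_stab.1 (Submodule.mem_points.1 hk) 0 h0S
    rwa [zero_add] at this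
  have hHW : H ≤ W := fun k hk =>
    Submodule.mem_points.1 (hSW (hHS (Submodule.mem_points.2 hk)))
  have hxH : ∀ k ∈ H, x + k ∉ S := by
    intro k hk h
    have := Finset.mem_stab.1 hk _ h
    rw [ZModModule.add_add_cancel_right] at this
    exact hxS this
  have hScard : S.card + H.points.card = W.points.card := by
    refine le_antisymm ?_ hstruct
    rw [← Finset.card_add_singleton H.points x, ← Finset.card_union_of_disjoint]
    · refine Finset.card_le_card (Finset.union_subset hSW (Finset.add_subset_points
        (Submodule.points_subset hHW) ?_))
      exact Finset.singleton_subset_iff.2 (Submodule.mem_points.2 hxW)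
    · rw [Finset.disjoint_left]
      intro y hy hy'
      rw [Finset.add_singleton_mem_iff, Submodule.mem_points] at hy'
      refine hxH _ hy' ?_
      rwa [add_comm y, ZModModule.add_add_cancel_left]
  set B := A + H.points with hB
  have hAB : A ⊆ B := fun a ha => Finset.mem_add.2 ⟨a, ha, 0, by simp, add_zero a⟩
  have hBW : B ⊆ W.points := Finset.add_subset_points hAW (Submodule.points_subset hHW)
  have hBper : ∀ b ∈ B, ∀ k ∈ H, b + k ∈ B := by
    intro b hb k hk
    obtain ⟨a, ha, l, hl, rfl⟩ := Finset.mem_add.1 hb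
    exact Finset.mem_add.2 ⟨a, ha, l + k,
      Submodule.mem_points.2 (H.add_mem (Submodule.mem_points.1 hl) hk), (add_assoc _ _ _).symm⟩
  -- `B` and `B + x` are disjoint because `x` is not a difference of elements of `B`.
  have hBle : 2 * B.card ≤ W.points.card := by
    have hdisj : Disjoint B (B + {x}) := by
      rw [Finset.disjoint_left]
      intro b hb hb'
      rw [Finset.add_singleton_mem_iff] at hb'
      obtain ⟨a, ha, k, hk, rfl⟩ := Finset.mem_add.1 hb
      obtain ⟨a', ha', k', hk', h⟩ := Finset.mem_add.1 hb'
      refine hxH (k + k')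
        (H.add_mem (Submodule.mem_points.1 hk) (Submodule.mem_points.1 hk')) ?_
      refine Finset.mem_add.2 ⟨a, ha, a', ha', ?_⟩
      have e1 : a' = a + k + x + k' := by rw [← h, ZModModule.add_add_cancel_right]
      rw [e1, add_assoc a, add_assoc a, ZModModule.add_add_cancel_left]
      abel
    have := Finset.card_le_card (Finset.union_subset hBW (Finset.add_subset_points hBW
      (Finset.singleton_subset_iff.2 (Submodule.mem_points.2 hxW))))
    rw [Finset.card_union_of_disjoint hdisj, Finset.card_add_singleton] at this
    omega
  obtain ⟨r, hr⟩ := Submodule.card_points_eq_two_pow_mul hHW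
  obtain ⟨j, hj⟩ := Submodule.card_points_dvd_card hBper
  have hABc := Finset.card_le_card hAB
  have hpos := H.card_points_pos
  have hr0 : r ≠ 0 := by
    rintro rfl
    have := Finset.card_pos.2 ⟨0, h0S⟩
    omega
  obtain ⟨q, rfl⟩ := Nat.exists_eq_add_one_of_ne_zero hr0
  have hjq : j = 2 ^ q := by
    have h1 : 2 * j ≤ 2 * 2 ^ q := by
      refine Nat.le_of_mul_le_mul_left (c := H.points.card) ?_ hpos
      rw [pow_succ] at hr
      nlinarith
    have h2 : 2 * 2 ^ q < 2 * j + 1 := by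
      refine Nat.lt_of_mul_lt_mul_left (a := H.points.card) ?_
      rw [pow_succ] at hr
      nlinarith
    omega
  refine ⟨hHW, hScard, ?_, q + 1, ?_, hr⟩
  · rw [hj, hr, hjq, pow_succ]; ring
  · -- If `B` were a single coset of `H`, then `A ⊆ H`, so `W = H` would lie in the sumset.
    by_contra hlt
    obtain rfl : q = 0 := by omega
    have hHB : H.points ⊆ B := fun k hk => Finset.mem_add.2 ⟨0, h0, k, hk, zero_add k⟩
    have hBH : H.points = B :=
      Finset.eq_of_subset_of_card_le hHB (by rw [hj, hjq]; simp)
    have : W ≤ H := Submodule.span_le.2 fun a ha =>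
      Submodule.mem_points.1 (hBH ▸ hAB ha)
    exact hxS (hHS (Submodule.mem_points.2 (this hxW)))

/-- If the complement of `A + A` is nonempty and the `H`-periodic hull of `A` contains a coset of a
subspace `V` of index four in `W`, then a translate of that coset avoids `A + V`, so three cosets
of `V` suffice. -/
theorem Finset.card_add_points_le_three_mul {A : Finset E} {W V : Submodule (ZMod 2) E}
    (hAW : A ⊆ W.points) (hVW : V ≤ W) (hcard : W.points.card = 4 * V.points.card) {x b : E}
    (hxW : x ∈ W) (hxS : x ∉ A + A) (hbW : b ∈ W)
    (hb : ∀ v ∈ V, b + v ∈ A + (A + A).stab.points) :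
    (A + V.points).card ≤ 3 * V.points.card := by
  have hdisj : Disjoint (A + V.points) (V.points + {x + b}) := by
    rw [Finset.disjoint_left]
    intro y hy hy'
    rw [Finset.add_singleton_mem_iff, Submodule.mem_points] at hy'
    obtain ⟨a, ha, v, hv, rfl⟩ := Finset.mem_add.1 hy
    have h1 := V.add_mem (Submodule.mem_points.1 hv) hy'
    obtain ⟨a', ha', k, hk, h⟩ := Finset.mem_add.1 (hb _ h1)
    have h2 := Finset.mem_stab.1 (Submodule.mem_points.1 hk) _
      (Finset.mem_add.2 ⟨a, ha, a', ha', rfl⟩)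
    refine hxS ?_
    have e : a + a' + k = x := by
      rw [add_assoc, h]
      have : a + (b + (v + (a + v + (x + b)))) = (a + a) + (b + b) + (v + v) + x := by abel
      simp only [this, ZModModule.add_self, zero_add]
    rwa [e] at h2
  have hVW' := Submodule.points_subset hVW
  have := Finset.card_le_card (Finset.union_subset (Finset.add_subset_points hAW hVW')
    (Finset.add_subset_points hVW' (Finset.singleton_subset_iff.2
      (Submodule.mem_points.2 (W.add_mem hxW hbW)))))
  rw [Finset.card_union_of_disjoint hdisj, Finset.card_add_singleton] at this
  omega

/-- A union of eight cosets of `H` in a space of sixteen cosets contains two different pairs of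
cosets with the same sum, hence a coset of a subspace with `4|H|` elements. -/
theorem Finset.exists_coset_subset {W H : Submodule (ZMod 2) E} {B : Finset E} (hHW : H ≤ W)
    (hBW : B ⊆ W.points) (hB : ∀ b ∈ B, ∀ k ∈ H, b + k ∈ B)
    (hW : W.points.card = 16 * H.points.card) (hBc : B.card = 8 * H.points.card) :
    ∃ V ≤ W, V.points.card = 4 * H.points.card ∧ ∃ b ∈ B, ∀ v ∈ V, b + v ∈ B := by
  have hpos := H.card_points_pos
  set h := H.points.card with hh
  -- Count the ordered pairs of elements of `B` from different cosets of `H`.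
  set P := (B ×ˢ B).filter (fun p => p.1 + p.2 ∉ H.points) with hP
  have hPcard : 56 * h * h ≤ P.card := by
    have h1 : ((B ×ˢ B).filter (fun p => p.1 + p.2 ∈ H.points)).card ≤ 8 * h * h := by
      rw [← hBc, hh, ← Finset.card_product]
      refine Finset.card_le_card_of_injOn (fun p => (p.1, p.1 + p.2)) ?_ ?_
      · intro p hp
        obtain ⟨hp1, hp2⟩ := Finset.mem_filter.1 hp
        exact Finset.mem_coe.2 (Finset.mem_product.2 ⟨(Finset.mem_product.1 hp1).1, hp2⟩)
      · intro p _ p' _ heq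
        obtain ⟨e1, e2⟩ := Prod.mk.inj heq
        rw [e1] at e2
        exact Prod.ext e1 (add_left_cancel e2)
    have h2 := Finset.card_filter_add_card_filter_not (s := B ×ˢ B)
      (fun p => p.1 + p.2 ∈ H.points)
    rw [Finset.card_product, hBc] at h2
    have : 8 * h * (8 * h) = 64 * h * h := by ring
    have : P.card = ((B ×ˢ B).filter (fun p => ¬ p.1 + p.2 ∈ H.points)).card := rfl
    nlinarith
  have hmaps : ∀ p ∈ P, p.1 + p.2 ∈ W.points \ H.points := by
    intro p hp
    obtain ⟨hp1, hp2⟩ := Finset.mem_filter.1 hp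
    obtain ⟨ha, hb⟩ := Finset.mem_product.1 hp1
    exact Finset.mem_sdiff.2 ⟨Submodule.mem_points.2 (W.add_mem
      (Submodule.mem_points.1 (hBW ha)) (Submodule.mem_points.1 (hBW hb))), hp2⟩
  have hWH : (W.points \ H.points).card = 15 * h := by
    rw [Finset.card_sdiff_of_subset (Submodule.points_subset hHW), hW]
    omega
  obtain ⟨w, hw, hwc⟩ := Finset.exists_lt_card_fiber_of_mul_lt_card_of_maps_to
    (n := 2 * h) hmaps (by rw [hWH]; nlinarith)
  obtain ⟨hwW, hwH⟩ := Finset.mem_sdiff.1 hw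
  rw [Submodule.mem_points] at hwW hwH
  set C := B.filter (fun b => b + w ∈ B) with hC
  have hCc : 2 * h < C.card := by
    refine hwc.trans_le (Finset.card_le_card_of_injOn Prod.fst ?_ ?_)
    · intro p hp
      obtain ⟨hp1, hp2⟩ := Finset.mem_filter.1 hp
      obtain ⟨ha, hb⟩ := Finset.mem_product.1 (Finset.mem_filter.1 hp1).1
      refine Finset.mem_coe.2 (Finset.mem_filter.2 ⟨ha, ?_⟩)
      rwa [← hp2, ZModModule.add_add_cancel_left]
    · intro p hp p' hp' heq
      have e1 := (Finset.mem_filter.1 hp).2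
      have e2 := (Finset.mem_filter.1 hp').2
      rw [← e2] at e1
      rw [heq] at e1
      exact Prod.ext heq (add_left_cancel e1)
  obtain ⟨b, hb⟩ : C.Nonempty := Finset.card_pos.1 (by omega)
  set U := H ⊔ Submodule.span (ZMod 2) {w} with hU
  have hUc : U.points.card = 2 * h := Submodule.card_points_sup_span_singleton hwH
  -- The fibre has more than `2h` elements, so it leaves the coset of `H + ⟨w⟩` that contains `b`.
  obtain ⟨c, hc, hcU⟩ : ∃ c ∈ C, c ∉ U.points + {b} := by
    by_contra hcon
    push Not at hcon
    have := Finset.card_le_card (show C ⊆ U.points + {b} from hcon)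
    rw [Finset.card_add_singleton] at this
    omega
  rw [Finset.add_singleton_mem_iff, Submodule.mem_points] at hcU
  have hCW : ∀ c ∈ C, c ∈ W := fun c hc =>
    Submodule.mem_points.1 (hBW (Finset.mem_filter.1 hc).1)
  have hCU : ∀ c ∈ C, ∀ u ∈ U, c + u ∈ B := by
    intro c hc u hu
    obtain ⟨h1, h2⟩ := Finset.mem_filter.1 hc
    rcases Submodule.mem_sup_span_singleton.1 hu with hu | hu
    · exact hB _ h1 _ hu
    · have := hB _ h2 _ hu
      have e : c + w + (u + w) = c + u := by
        rw [add_add_add_comm, ZModModule.add_self, add_zero]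
      rwa [e] at this
  have hUW : U ≤ W := sup_le hHW ((Submodule.span_singleton_le_iff_mem _ _).2 hwW)
  refine ⟨U ⊔ Submodule.span (ZMod 2) {c + b}, sup_le hUW
    ((Submodule.span_singleton_le_iff_mem _ _).2 (W.add_mem (hCW c hc) (hCW b hb))), ?_,
    b, (Finset.mem_filter.1 hb).1, ?_⟩
  · rw [Submodule.card_points_sup_span_singleton hcU, hUc]
    ring
  · intro v hv
    rcases Submodule.mem_sup_span_singleton.1 hv with hv | hv
    · exact hCU b hb v hv
    · have := hCU c hc _ hv
      have e : c + (v + (c + b)) = b + v := by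
        rw [add_left_comm, ZModModule.add_add_cancel_left, add_comm]
      rwa [e] at this

/-- The three covering bounds for sets that contain `0`. -/
theorem Finset.hasSubspaceCover_of_zero_mem {A : Finset E} (h0 : 0 ∈ A)
    (hA : (A + A).card < 2 * A.card) :
    A.HasSubspaceCover 4 ∧ (16 * (A + A).card ≤ 31 * A.card → A.HasSubspaceCover 3) ∧
      (4 * (A + A).card ≤ 7 * A.card → A.HasSubspaceCover 2) := by
  set W := Submodule.span (ZMod 2) (A : Set E) with hW
  have hAW : A ⊆ W.points := fun a ha => Submodule.mem_points.2 (Submodule.subset_span ha)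
  have hAWc := Finset.card_le_card hAW
  have hApos : 0 < A.card := Finset.card_pos.2 ⟨0, h0⟩
  have hSW : A + A ⊆ W.points := Finset.add_subset_points hAW hAW
  have hcov : ∀ V ≤ W, ∀ g : ℕ, V.points.card ≤ A.card → W.points.card ≤ g * V.points.card →
      A.HasSubspaceCover g := fun V hVW g h1 h2 =>
    ⟨V, h1, (Finset.card_le_card (Finset.add_subset_points hAW
      (Submodule.points_subset hVW))).trans h2⟩
  -- A set with at least half of the elements of its span is covered by two cosets.
  have hhalf : W.points.card ≤ 2 * A.card → A.HasSubspaceCover 2 := by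
    intro h
    rcases lt_or_ge 1 W.points.card with h1 | h1
    · obtain ⟨V, hVW, hV⟩ := Submodule.exists_le_two_mul_card h1
      exact hcov V hVW 2 (by omega) (by omega)
    · exact hcov W le_rfl 2 (by omega) (by omega)
  by_cases hall : W.points ⊆ A + A
  · have h := hhalf ((Finset.card_le_card hall).trans hA.le)
    exact ⟨h.mono (by norm_num), fun _ => h.mono (by norm_num), fun _ => h⟩
  obtain ⟨x, hxW, hxS⟩ := Finset.not_subset.1 hall
  rw [Submodule.mem_points] at hxW
  obtain ⟨hHW, hScard, hBcard, r, hr, hWcard⟩ := Finset.card_of_add_self_ne_span h0 hA hxW hxS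
  rw [← hW] at hHW hScard hBcard hWcard
  set H := (A + A).stab with hH
  set B := A + H.points with hB
  have hBW : B ⊆ W.points := Finset.add_subset_points hAW (Submodule.points_subset hHW)
  have hBper : ∀ b ∈ B, ∀ k ∈ H, b + k ∈ B := by
    intro b hb k hk
    obtain ⟨a, ha, l, hl, rfl⟩ := Finset.mem_add.1 hb
    exact Finset.mem_add.2 ⟨a, ha, l + k,
      Submodule.mem_points.2 (H.add_mem (Submodule.mem_points.1 hl) hk), (add_assoc _ _ _).symm⟩
  have hpos := H.card_points_pos
  set h := H.points.card with hh
  have hWr : 4 * h ≤ W.points.card := by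
    rw [hWcard]
    exact Nat.mul_le_mul_right _ (Nat.pow_le_pow_right (n := 2) (by norm_num) hr)
  by_cases hfull : W.points.card ≤ 2 * A.card
  · have h := hhalf hfull
    exact ⟨h.mono (by norm_num), fun _ => h.mono (by norm_num), fun _ => h⟩
  push Not at hfull
  have hr2 : r = 2 → A.HasSubspaceCover 2 := by
    rintro rfl
    exact ⟨H, by omega, by change B.card ≤ _; omega⟩
  -- From here on `A` has doubling more than `2 - 2 / 2 ^ r`, so a bound on the doubling bounds `r`.
  have hrlt : ∀ n : ℕ, W.points.card < 2 ^ n * h → r < n := by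
    intro n hn
    rw [hWcard] at hn
    exact (Nat.pow_lt_pow_iff_right (by norm_num)).1 (Nat.lt_of_mul_lt_mul_right hn)
  refine ⟨?_, ?_, ?_⟩
  · obtain ⟨V, hVW, hV⟩ := Submodule.exists_le_two_mul_card (W := W) (by omega)
    obtain ⟨V', hVV', hV'⟩ := Submodule.exists_le_two_mul_card (W := V) (by omega)
    exact hcov V' (hVV'.trans hVW) 4 (by omega) (by omega)
  · intro hK
    have hr5 : r < 5 := hrlt 5 (by omega)
    obtain rfl | rfl | rfl : r = 2 ∨ r = 3 ∨ r = 4 := by omega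
    · exact (hr2 rfl).mono (by norm_num)
    · have h0B : 0 ∈ B := Finset.mem_add.2 ⟨0, h0, 0, by simp, add_zero 0⟩
      obtain ⟨b, hb, hbH⟩ : ∃ b ∈ B, b ∉ H.points := by
        by_contra hcon
        push Not at hcon
        have := Finset.card_le_card (show B ⊆ H.points from hcon)
        omega
      rw [Submodule.mem_points] at hbH
      have hVc := Submodule.card_points_sup_span_singleton hbH
      refine ⟨H ⊔ Submodule.span (ZMod 2) {b}, by omega,
        Finset.card_add_points_le_three_mul hAW (sup_le hHW
          ((Submodule.span_singleton_le_iff_mem _ _).2 (Submodule.mem_points.1 (hBW hb))))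
          (by omega) hxW hxS W.zero_mem ?_⟩
      intro v hv
      rw [zero_add]
      rcases Submodule.mem_sup_span_singleton.1 hv with hv | hv
      · have := hBper 0 h0B v hv
        rwa [zero_add] at this
      · have := hBper b hb _ hv
        rwa [add_comm v, ZModModule.add_add_cancel_left] at this
    · obtain ⟨V, hVW, hVc, b, hb, hbV⟩ :=
        Finset.exists_coset_subset hHW hBW hBper (by omega) (by omega)
      exact ⟨V, by omega, Finset.card_add_points_le_three_mul hAW hVW (by omega) hxW hxS
        (Submodule.mem_points.1 (hBW hb)) hbV⟩
  · intro hK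
    have hr3 : r < 3 := hrlt 3 (by omega)
    exact hr2 (by omega)

theorem Finset.hasSubspaceCover_of_card_add_self_lt {A : Finset E} (hne : A.Nonempty)
    (hA : (A + A).card < 2 * A.card) :
    A.HasSubspaceCover 4 ∧ (16 * (A + A).card ≤ 31 * A.card → A.HasSubspaceCover 3) ∧
      (4 * (A + A).card ≤ 7 * A.card → A.HasSubspaceCover 2) := by
  obtain ⟨a, ha⟩ := hne
  have hc : (A + {a}).card = A.card := Finset.card_add_singleton _ _
  have hS : A + {a} + (A + {a}) = A + A := by
    rw [add_add_add_comm, Finset.singleton_add_singleton, ZModModule.add_self,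
      Finset.singleton_zero, add_zero]
  have h := Finset.hasSubspaceCover_of_zero_mem (A := A + {a})
    (Finset.add_singleton_mem_iff.2 (by rwa [zero_add])) (by rwa [hS, hc])
  rw [hS, hc] at h
  exact ⟨Finset.hasSubspaceCover_of_add_singleton h.1,
    fun hK => Finset.hasSubspaceCover_of_add_singleton (h.2.1 hK),
    fun hK => Finset.hasSubspaceCover_of_add_singleton (h.2.2 hK)⟩

end UpperBounds

section Translates

/-- `A` is covered by as many translates of `V` as there are cosets of `V` meeting it. -/
theorem isCoveredByTranslates_of_hasSubspaceCover {m : ℕ} {A : Finset (Fin m → ZMod 2)} {g : ℕ}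
    (h : A.HasSubspaceCover g) : IsCoveredByTranslates A g := by
  obtain ⟨V, hV, hAV⟩ := h
  have : DecidableEq ((Fin m → ZMod 2) ⧸ V) := Classical.decEq _
  rw [Submodule.card_add_points] at hAV
  refine ⟨V, by rwa [← Submodule.card_points], (A.image V.mkQ).image Quotient.out,
    Finset.card_image_le.trans (Nat.le_of_mul_le_mul_right hAV V.card_points_pos), ?_⟩
  intro a ha
  refine Set.mem_iUnion₂.2 ⟨(V.mkQ a).out,
    Finset.mem_image_of_mem _ (Finset.mem_image_of_mem _ ha), ?_⟩
  rw [Set.mem_vadd_set_iff_neg_vadd_mem, vadd_eq_add, ZModModule.neg_eq_self, SetLike.mem_coe,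
    ← Submodule.mkQ_eq_iff]
  exact Quotient.out_eq (V.mkQ a)

/-- Conversely, a covering by `g` translates of `V` bounds the size of `A + V`. -/
theorem hasSubspaceCover_of_isCoveredByTranslates {m : ℕ} {A : Finset (Fin m → ZMod 2)} {g : ℕ}
    (h : IsCoveredByTranslates A g) : A.HasSubspaceCover g := by
  obtain ⟨V, hV, T, hT, hAT⟩ := h
  refine ⟨V, by rwa [Submodule.card_points], ?_⟩
  have hsub : A + V.points ⊆ T + V.points := by
    intro y hy
    obtain ⟨a, ha, v, hv, rfl⟩ := Finset.mem_add.1 hy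
    obtain ⟨t, ht, hat⟩ := Set.mem_iUnion₂.1 (hAT ha)
    obtain ⟨w, hw, rfl⟩ := Set.mem_vadd_set.1 hat
    rw [vadd_eq_add, add_assoc]
    exact Finset.mem_add.2 ⟨t, ht, _,
      Submodule.mem_points.2 (V.add_mem hw (Submodule.mem_points.1 hv)), rfl⟩
  exact (Finset.card_le_card hsub).trans
    (Finset.card_add_le.trans (Nat.mul_le_mul_right _ hT))

end Translates

/-! ### Punctured quadrics that need many translates -/

section Quadrics

variable {E : Type*} [AddCommGroup E] [Fintype E] [DecidableEq E]

/-- The zero set of `F` without the origin. Removing one point keeps subspaces with half of the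
elements of `E` out of the competition. -/
def puncturedZeros (F : E → ZMod 2) : Finset E := (Finset.univ.filter fun y => F y = 0).erase 0

theorem mem_puncturedZeros {F : E → ZMod 2} {y : E} : y ∈ puncturedZeros F ↔ y ≠ 0 ∧ F y = 0 := by
  simp [puncturedZeros]

variable [Module (ZMod 2) E]

theorem ZMod.two_eq_one_of_ne_zero : ∀ {a : ZMod 2}, a ≠ 0 → a = 1 := by decide

/-- A translation that changes the value of `F` everywhere pairs off zeros and non-zeros. -/
theorem card_puncturedZeros {F : E → ZMod 2} {x : E} (hF0 : F 0 = 0)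
    (hx : ∀ y, F (y + x) = F y + 1) : 2 * (puncturedZeros F).card + 2 = Fintype.card E := by
  have h1 := Finset.card_filter_add_card_filter_not (s := (Finset.univ : Finset E))
    (fun y => F y = 0)
  have h2 : (Finset.univ.filter fun y => ¬ F y = 0).card =
      (Finset.univ.filter fun y => F y = 0).card := by
    rw [← Finset.card_add_singleton (Finset.univ.filter fun y => F y = 0) x]
    congr 1
    ext y
    rw [Finset.add_singleton_mem_iff]
    simp only [Finset.mem_filter, Finset.mem_univ, true_and, hx]
    generalize F y = a
    decide +revert
  have h3 := Finset.card_erase_add_one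
    (show (0 : E) ∈ Finset.univ.filter fun y => F y = 0 by simpa using hF0)
  rw [Finset.card_univ] at h1
  rw [puncturedZeros]
  omega

/-- Let `F` be a quadratic function and `x` a translation that changes all its values. A coset of
`V` without points of the punctured zero set carries the constant value `1` up to one point, so
`V` does not contain `x`, is isotropic for the polarization of `F`, and remains so after adding
`x`. -/
theorem isotropic_of_coset_disjoint {F : E → ZMod 2} {x p : E} {V : Submodule (ZMod 2) E}
    (hx : ∀ y, F (y + x) = F y + 1)
    (hF : ∀ q u v, F q + F (q + u) + F (q + v) + F (q + u + v) = F u + F v + F (u + v))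
    (hV : 4 < V.points.card) (hp : ∀ v ∈ V, p + v ∉ puncturedZeros F) :
    x ∉ V ∧ ∀ u ∈ V ⊔ Submodule.span (ZMod 2) {x}, ∀ v ∈ V ⊔ Submodule.span (ZMod 2) {x},
      F u + F v + F (u + v) = 0 := by
  have hone : ∀ t ∈ V, p + t ≠ 0 → F (p + t) = 1 := by
    intro t ht h0
    by_contra h
    exact hp t ht (mem_puncturedZeros.2
      ⟨h0, not_not.1 fun h' => h (ZMod.two_eq_one_of_ne_zero h')⟩)
  -- Choose a base point in the coset for which all relevant points differ from the origin.
  have hbase : ∀ u ∈ V, ∀ v ∈ V, F u + F v + F (u + v) = 0 ∧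
      (∃ t ∈ V, F (p + t) = 1 ∧ F (p + t + u) = 1) := by
    intro u hu v hv
    obtain ⟨t, ht, htn⟩ : ∃ t ∈ V.points, t ∉ ({p, p + u, p + v, p + (u + v)} : Finset E) :=
      Finset.exists_mem_notMem_of_card_lt_card (lt_of_le_of_lt Finset.card_le_four hV)
    rw [Submodule.mem_points] at ht
    simp only [Finset.mem_insert, Finset.mem_singleton, not_or] at htn
    obtain ⟨n1, n2, n3, n4⟩ := htn
    have aux : ∀ w ∈ V, t ≠ p + w → F (p + t + w) = 1 := by
      intro w hw hne
      rw [add_assoc]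
      refine hone _ (V.add_mem ht hw) fun h0 => hne ?_
      have e : t = p + (p + (t + w)) + w := by
        rw [ZModModule.add_add_cancel_left, ZModModule.add_add_cancel_right]
      rw [h0, add_zero] at e
      exact e
    have f1 := aux 0 V.zero_mem (by rwa [add_zero])
    rw [add_zero] at f1
    have f2 := aux u hu n2
    have f3 := aux v hv n3
    have f4 := aux _ (V.add_mem hu hv) n4
    refine ⟨?_, t, ht, f1, f2⟩
    rw [← hF (p + t) u v, f1, f2, f3, add_assoc (p + t), f4]
    decide
  refine ⟨fun hxV => ?_, ?_⟩
  · obtain ⟨t, -, h1, h2⟩ := (hbase x hxV x hxV).2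
    rw [hx, h1] at h2
    exact absurd h2 (by decide)
  · have hshift : ∀ u v, F (u + x) + F v + F (u + x + v) = F u + F v + F (u + v) := by
      intro u v
      rw [add_right_comm u x v, hx, hx]
      generalize F u = a; generalize F v = b; generalize F (u + v) = c
      decide +revert
    have hleft : ∀ u ∈ V, ∀ v ∈ V ⊔ Submodule.span (ZMod 2) {x}, F u + F v + F (u + v) = 0 := by
      intro u hu v hv
      rcases Submodule.mem_sup_span_singleton.1 hv with hv | hv
      · exact (hbase u hu v hv).1
      · rw [add_comm (F u), add_comm u, ← hshift, add_comm (F (v + x)), add_comm (v + x)]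
        exact (hbase u hu _ hv).1
    intro u hu v hv
    rcases Submodule.mem_sup_span_singleton.1 hu with hu | hu
    · exact hleft u hu v hv
    · rw [← hshift]
      exact hleft _ hu v hv

theorem Submodule.mem_or_add_mem_of_card {U : Submodule (ZMod 2) E}
    (hU : 2 * U.points.card = Fintype.card E) (u v : E) : u ∈ U ∨ v ∈ U ∨ u + v ∈ U := by
  by_contra! h
  obtain ⟨hu, hv, huv⟩ := h
  have hc := Submodule.card_points_sup_span_singleton hu
  rw [hU] at hc
  have hv' : v ∈ (U ⊔ Submodule.span (ZMod 2) {u}).points := by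
    rw [Finset.eq_univ_of_card _ hc]
    exact Finset.mem_univ v
  rw [Submodule.mem_points, Submodule.mem_sup_span_singleton, add_comm v u] at hv'
  exact hv'.elim hv huv

/-- A covering by at most three translates uses a subspace of index exactly four. -/
theorem four_mul_card_of_puncturedZeros {F : E → ZMod 2} {x : E} {V : Submodule (ZMod 2) E}
    (hF0 : F 0 = 0) (hx : ∀ y, F (y + x) = F y + 1) (hE : 8 < Fintype.card E)
    (hV : V.points.card ≤ (puncturedZeros F).card)
    (hcov : (puncturedZeros F + V.points).card ≤ 3 * V.points.card) :
    4 * V.points.card = Fintype.card E := by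
  have hA := card_puncturedZeros hF0 hx
  have htop : (⊤ : Submodule (ZMod 2) E).points = Finset.univ := by ext y; simp
  obtain ⟨r, hr⟩ := Submodule.card_points_eq_two_pow_mul (le_top : V ≤ ⊤)
  rw [htop, Finset.card_univ] at hr
  have hAV : (puncturedZeros F).card ≤ (puncturedZeros F + V.points).card :=
    Finset.card_le_card fun a ha => Finset.mem_add.2 ⟨a, ha, 0, by simp, add_zero a⟩
  rcases r with _ | _ | _ | r
  · omega
  · omega
  · omega
  · have : 1 ≤ 2 ^ r := Nat.one_le_two_pow
    rw [hr] at hA hE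
    rw [pow_succ, pow_succ, pow_succ] at hA hE
    have : 8 * V.points.card ≤ 2 ^ r * 2 * 2 * 2 * V.points.card := by nlinarith
    omega

/-- If three translates of a subspace of suitable size cover the punctured zero set, there is a
hyperplane on which the polarization of `F` vanishes. -/
theorem exists_hyperplane_of_hasSubspaceCover_three {F : E → ZMod 2} {x : E}
    (hF0 : F 0 = 0) (hx : ∀ y, F (y + x) = F y + 1)
    (hF : ∀ q u v, F q + F (q + u) + F (q + v) + F (q + u + v) = F u + F v + F (u + v))
    (hE : 16 < Fintype.card E) (h : (puncturedZeros F).HasSubspaceCover 3) :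
    ∃ U : Submodule (ZMod 2) E, 2 * U.points.card = Fintype.card E ∧
      ∀ u ∈ U, ∀ v ∈ U, F u + F v + F (u + v) = 0 := by
  obtain ⟨V, hV, hcov⟩ := h
  have hVc := four_mul_card_of_puncturedZeros hF0 hx (by omega) hV hcov
  obtain ⟨p, hp⟩ : ∃ p, p ∉ puncturedZeros F + V.points := by
    by_contra! hcon
    rw [Finset.eq_univ_iff_forall.2 hcon, Finset.card_univ] at hcov
    omega
  obtain ⟨hxV, hiso⟩ := isotropic_of_coset_disjoint (p := p) hx hF (by omega) fun v hv h =>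
    hp (Finset.mem_add.2 ⟨_, h, v, Submodule.mem_points.2 hv,
      ZModModule.add_add_cancel_right p v⟩)
  refine ⟨_, ?_, hiso⟩
  rw [Submodule.card_points_sup_span_singleton hxV]
  omega

/-- If two translates of a subspace of suitable size cover the punctured zero set, the polarization
of `F` vanishes. -/
theorem isotropic_of_hasSubspaceCover_two {F : E → ZMod 2} {x : E}
    (hF0 : F 0 = 0) (hx : ∀ y, F (y + x) = F y + 1)
    (hF : ∀ q u v, F q + F (q + u) + F (q + v) + F (q + u + v) = F u + F v + F (u + v))
    (hE : 16 < Fintype.card E) (h : (puncturedZeros F).HasSubspaceCover 2) (u v : E) :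
    F u + F v + F (u + v) = 0 := by
  obtain ⟨V, hV, hcov⟩ := h
  have hVc := four_mul_card_of_puncturedZeros hF0 hx (by omega) hV (by omega)
  have hAc := card_puncturedZeros hF0 hx
  set A := puncturedZeros F with hA
  -- The two translates of `V` form one coset of the subspace `U` spanned by `V` and `a + b`.
  obtain ⟨a, ha⟩ : A.Nonempty := Finset.card_pos.1 (by omega)
  obtain ⟨b, hb, hbV⟩ : ∃ b ∈ A, b ∉ V.points + {a} := by
    refine Finset.exists_mem_notMem_of_card_lt_card ?_
    rw [Finset.card_add_singleton]
    omega
  rw [Finset.add_singleton_mem_iff, Submodule.mem_points] at hbV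
  set U := V ⊔ Submodule.span (ZMod 2) {b + a} with hU
  have hUc : U.points.card = 2 * V.points.card := Submodule.card_points_sup_span_singleton hbV
  have hsub : U.points + {a} ⊆ A + V.points := by
    intro y hy
    rw [Finset.add_singleton_mem_iff, Submodule.mem_points,
      Submodule.mem_sup_span_singleton] at hy
    rcases hy with hy | hy
    · refine Finset.mem_add.2 ⟨a, ha, _, Submodule.mem_points.2 hy, ?_⟩
      rw [add_comm y, ZModModule.add_add_cancel_left]
    · refine Finset.mem_add.2 ⟨b, hb, _, Submodule.mem_points.2 hy, ?_⟩
      rw [add_left_comm, ZModModule.add_add_cancel_left, ZModModule.add_add_cancel_right]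
  have heq : U.points + {a} = A + V.points := by
    refine Finset.eq_of_subset_of_card_le hsub ?_
    rw [Finset.card_add_singleton]
    omega
  obtain ⟨p, hp⟩ : ∃ p, p ∉ U.points + {a} := by
    by_contra! hcon
    have := congrArg Finset.card (Finset.eq_univ_iff_forall.2 hcon)
    rw [Finset.card_add_singleton, Finset.card_univ] at this
    omega
  obtain ⟨hxU, hiso⟩ := isotropic_of_coset_disjoint (V := U) (p := p) hx hF (by omega) (by
    intro w hw hmem
    have h1 : p + w ∈ U.points + {a} := by
      rw [heq]
      exact Finset.mem_add.2 ⟨_, hmem, 0, by simp, add_zero _⟩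
    rw [Finset.add_singleton_mem_iff, Submodule.mem_points] at h1 hp
    rw [add_right_comm] at h1
    exact hp ((U.add_mem_iff_left hw).1 h1))
  have htop : (U ⊔ Submodule.span (ZMod 2) {x}).points = Finset.univ := by
    refine Finset.eq_univ_of_card _ ?_
    rw [Submodule.card_points_sup_span_singleton hxU]
    omega
  have hmem : ∀ y, y ∈ U ⊔ Submodule.span (ZMod 2) {x} := fun y => by
    rw [← Submodule.mem_points, htop]; exact Finset.mem_univ y
  exact hiso u (hmem u) v (hmem v)

end Quadrics

section Cylinders

variable {k n : ℕ}

/-- The function on `𝔽₂^(k+n)` that applies `f` to the first `k` coordinates. -/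
def cylinder (n : ℕ) (f : (Fin k → ZMod 2) → ZMod 2) (y : Fin (k + n) → ZMod 2) : ZMod 2 :=
  f fun i => y (Fin.castAdd n i)

theorem cylinder_append (f : (Fin k → ZMod 2) → ZMod 2) (z : Fin k → ZMod 2)
    (w : Fin n → ZMod 2) : cylinder n f (Fin.append z w) = f z := by
  simp [cylinder]

theorem append_zero_add (z z' : Fin k → ZMod 2) :
    Fin.append z (0 : Fin n → ZMod 2) + Fin.append z' 0 = Fin.append (z + z') 0 := by
  ext i
  refine Fin.addCases (fun i => ?_) (fun i => ?_) i <;> simp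

theorem cylinder_add_append {f : (Fin k → ZMod 2) → ZMod 2} {x : Fin k → ZMod 2}
    (hx : ∀ z, f (z + x) = f z + 1) (y : Fin (k + n) → ZMod 2) :
    cylinder n f (y + Fin.append x 0) = cylinder n f y + 1 := by
  rw [cylinder, cylinder, ← hx]
  congr 1
  ext i
  simp

/-- No two zeros of `f` differ by `x`, so the sumset misses the points that lie above `x`. -/
theorem card_add_puncturedZeros_cylinder_le {f : (Fin k → ZMod 2) → ZMod 2} {x : Fin k → ZMod 2}
    (hx : ∀ z, f (z + x) = f z + 1) :
    (puncturedZeros (cylinder n f) + puncturedZeros (cylinder n f)).card + 2 ^ n ≤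
      2 ^ (k + n) := by
  set A := puncturedZeros (cylinder n f)
  have hN : (Finset.univ.image fun w : Fin n → ZMod 2 => Fin.append x w).card = 2 ^ n := by
    rw [Finset.card_image_of_injective, Finset.card_univ, Fintype.card_fun, ZMod.card,
      Fintype.card_fin]
    intro w w' h
    ext i
    simpa using congrFun h (Fin.natAdd k i)
  have hdisj : Disjoint (A + A)
      (Finset.univ.image fun w : Fin n → ZMod 2 => Fin.append x w) := by
    rw [Finset.disjoint_left]
    intro y hy hy'
    obtain ⟨w, -, rfl⟩ := Finset.mem_image.1 hy'
    obtain ⟨a, ha, b, hb, h⟩ := Finset.mem_add.1 hy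
    have hfa := (mem_puncturedZeros.1 ha).2
    have hfb := (mem_puncturedZeros.1 hb).2
    have e : b = a + Fin.append x w := by rw [← h, ZModModule.add_add_cancel_left]
    have : cylinder n f b = cylinder n f a + 1 := by
      rw [cylinder, cylinder, ← hx, e]
      congr 1
      ext i
      simp
    rw [hfa, hfb] at this
    exact absurd this (by decide)
  rw [← hN, ← Finset.card_union_of_disjoint hdisj]
  refine (Finset.card_le_univ _).trans ?_
  rw [Fintype.card_fun, ZMod.card, Fintype.card_fin]

theorem two_mul_card_puncturedZeros_cylinder {f : (Fin k → ZMod 2) → ZMod 2}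
    {x : Fin k → ZMod 2} (hf0 : f 0 = 0) (hx : ∀ z, f (z + x) = f z + 1) :
    2 * (puncturedZeros (cylinder n f)).card + 2 = 2 ^ (k + n) := by
  have := card_puncturedZeros (F := cylinder n f) (x := Fin.append x 0) hf0
    (cylinder_add_append hx)
  rwa [Fintype.card_fun, ZMod.card, Fintype.card_fin] at this

/-- The quadratic function `z₀z₁ + z₂`, whose zeros are four affinely independent points. -/
def rankTwoQuadric (z : Fin 3 → ZMod 2) : ZMod 2 := z 0 * z 1 + z 2

/-- The quadratic function `z₀z₁ + z₂z₃ + z₄`, whose zero set is the graph of a bent function. -/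
def rankFourQuadric (z : Fin 5 → ZMod 2) : ZMod 2 := z 0 * z 1 + z 2 * z 3 + z 4

theorem rankTwoQuadric_add (z : Fin 3 → ZMod 2) :
    rankTwoQuadric (z + ![0, 0, 1]) = rankTwoQuadric z + 1 := by
  simp [rankTwoQuadric, add_assoc]

theorem rankFourQuadric_add (z : Fin 5 → ZMod 2) :
    rankFourQuadric (z + ![0, 0, 0, 0, 1]) = rankFourQuadric z + 1 := by
  simp [rankFourQuadric, add_assoc]

theorem rankTwoQuadric_polar (q u v : Fin 3 → ZMod 2) :
    rankTwoQuadric q + rankTwoQuadric (q + u) + rankTwoQuadric (q + v) +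
      rankTwoQuadric (q + u + v) =
    rankTwoQuadric u + rankTwoQuadric v + rankTwoQuadric (u + v) := by
  have h2 : (2 : ZMod 2) = 0 := rfl
  simp only [rankTwoQuadric, Pi.add_apply]
  linear_combination ((q 0 + u 0) * (q 1 + u 1) + (q 0 + v 0) * (q 1 + v 1) - u 0 * u 1 -
    v 0 * v 1 + 2 * q 2) * h2

theorem rankFourQuadric_polar (q u v : Fin 5 → ZMod 2) :
    rankFourQuadric q + rankFourQuadric (q + u) + rankFourQuadric (q + v) +
      rankFourQuadric (q + u + v) =
    rankFourQuadric u + rankFourQuadric v + rankFourQuadric (u + v) := by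
  have h2 : (2 : ZMod 2) = 0 := rfl
  simp only [rankFourQuadric, Pi.add_apply]
  linear_combination ((q 0 + u 0) * (q 1 + u 1) + (q 0 + v 0) * (q 1 + v 1) - u 0 * u 1 -
    v 0 * v 1 + (q 2 + u 2) * (q 3 + u 3) + (q 2 + v 2) * (q 3 + v 3) - u 2 * u 3 -
    v 2 * v 3 + 2 * q 4) * h2

theorem not_hasSubspaceCover_two (hn : 2 ≤ n) :
    ¬ (puncturedZeros (cylinder n rankTwoQuadric)).HasSubspaceCover 2 := by
  intro h
  have hE : 16 < Fintype.card (Fin (3 + n) → ZMod 2) := by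
    rw [Fintype.card_fun, ZMod.card, Fintype.card_fin]
    calc 16 < 2 ^ (3 + 2) := by norm_num
      _ ≤ 2 ^ (3 + n) := Nat.pow_le_pow_right (by norm_num) (by omega)
  have := isotropic_of_hasSubspaceCover_two (x := Fin.append ![0, 0, 1] 0)
    (by simp [cylinder, rankTwoQuadric]) (cylinder_add_append rankTwoQuadric_add)
    (fun _ _ _ => rankTwoQuadric_polar _ _ _) hE h
      (Fin.append ![1, 0, 0] 0) (Fin.append ![0, 1, 0] 0)
  rw [append_zero_add, cylinder_append, cylinder_append, cylinder_append] at this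
  exact absurd this (by decide)

/-- A hyperplane has too large a dimension to be isotropic for the polarization of
`z₀z₁ + z₂z₃ + z₄`. -/
theorem not_hasSubspaceCover_three :
    ¬ (puncturedZeros (cylinder n rankFourQuadric)).HasSubspaceCover 3 := by
  intro h
  have hE : 16 < Fintype.card (Fin (5 + n) → ZMod 2) := by
    rw [Fintype.card_fun, ZMod.card, Fintype.card_fin]
    calc 16 < 2 ^ 5 := by norm_num
      _ ≤ 2 ^ (5 + n) := Nat.pow_le_pow_right (by norm_num) (by omega)
  obtain ⟨U, hUc, hU⟩ := exists_hyperplane_of_hasSubspaceCover_three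
    (x := Fin.append ![0, 0, 0, 0, 1] 0)
    (by simp [cylinder, rankFourQuadric]) (cylinder_add_append rankFourQuadric_add)
    (fun _ _ _ => rankFourQuadric_polar _ _ _) hE h
  let P : (Fin 5 → ZMod 2) → Prop := fun z => Fin.append z (0 : Fin n → ZMod 2) ∈ U
  have hidx : ∀ z z', P z ∨ P z' ∨ P (z + z') := by
    intro z z'
    have := Submodule.mem_or_add_mem_of_card hUc (Fin.append z 0) (Fin.append z' 0)
    rwa [append_zero_add] at this
  have hiso : ∀ z z', rankFourQuadric z + rankFourQuadric z' + rankFourQuadric (z + z') ≠ 0 →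
      ¬ (P z ∧ P z') := by
    rintro z z' hne ⟨hz, hz'⟩
    have := hU _ hz _ hz'
    rw [append_zero_add, cylinder_append, cylinder_append, cylinder_append] at this
    exact hne this
  let e : Fin 4 → Fin 5 → ZMod 2 := fun i => Pi.single i.castSucc 1
  have h01 := hiso (e 0) (e 1) (by decide)
  have h23 := hiso (e 2) (e 3) (by decide)
  have h0102 := hiso (e 0 + e 1) (e 0 + e 2) (by decide)
  have h021 := hiso (e 0 + e 2) (e 1) (by decide)
  have h023 := hiso (e 0 + e 2) (e 3) (by decide)
  have h032 := hiso (e 0 + e 3) (e 2) (by decide)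
  have h120 := hiso (e 1 + e 2) (e 0) (by decide)
  have h130 := hiso (e 1 + e 3) (e 0) (by decide)
  rcases hidx (e 0) (e 2) with h0 | h2 | h02
  · rcases hidx (e 1) (e 2) with h | h2 | h
    · exact h01 ⟨h0, h⟩
    · rcases hidx (e 1) (e 3) with h | h | h
      · exact h01 ⟨h0, h⟩
      · exact h23 ⟨h2, h⟩
      · exact h130 ⟨h, h0⟩
    · exact h120 ⟨h, h0⟩
  · rcases hidx (e 0) (e 3) with h0 | h | h
    · rcases hidx (e 1) (e 3) with h | h | h
      · exact h01 ⟨h0, h⟩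
      · exact h23 ⟨h2, h⟩
      · exact h130 ⟨h, h0⟩
    · exact h23 ⟨h2, h⟩
    · exact h032 ⟨h, h2⟩
  · rcases hidx (e 0) (e 1) with h0 | h | h
    · rcases hidx (e 1) (e 3) with h | h | h
      · exact h01 ⟨h0, h⟩
      · exact h023 ⟨h02, h⟩
      · exact h130 ⟨h, h0⟩
    · exact h021 ⟨h02, h⟩
    · exact h0102 ⟨h, h02⟩

end Cylinders

/-! ### The values of the covering function -/

theorem addConst_le_iff {m : ℕ} {A : Finset (Fin m → ZMod 2)} (hA : A.Nonempty) {K : ℝ} :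
    ((A.addConst A : ℚ≥0) : ℝ) ≤ K ↔ ((A + A).card : ℝ) ≤ K * A.card := by
  have hpos : (0 : ℝ) < A.card := by exact_mod_cast hA.card_pos
  rw [Finset.addConst, NNRat.cast_div, NNRat.cast_natCast, NNRat.cast_natCast, div_le_iff₀ hpos]

theorem exists_two_pow_bound {K : ℝ} {c d : ℕ} (h : c < K * d) :
    ∃ n : ℕ, 2 ≤ n ∧ (c * 2 ^ n : ℝ) ≤ K * (d * 2 ^ n - 1) := by
  obtain ⟨n, hn⟩ := pow_unbounded_of_one_lt (K / (K * d - c)) (one_lt_two : (1 : ℝ) < 2)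
  have hpos : 0 < K * d - c := by linarith
  rw [div_lt_iff₀ hpos] at hn
  refine ⟨n + 2, by omega, ?_⟩
  have : (0 : ℝ) < 2 ^ n * (K * d - c) := by positivity
  rw [pow_add]
  nlinarith

/-- A set whose size is one less than a multiple of `2 ^ n` and that is not covered by `g`
translates excludes `g` from the covering bounds. -/
theorem notMem_coveringBounds {K : ℝ} {c d g n m : ℕ} (hm : 0 < m) (hd : 0 < d) (hn : 2 ≤ n)
    (hK : (c * 2 ^ n : ℝ) ≤ K * (d * 2 ^ n - 1)) {A : Finset (Fin m → ZMod 2)}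
    (hA : A.card + 1 = d * 2 ^ n) (hAA : (A + A).card ≤ c * 2 ^ n)
    (hcov : ¬ A.HasSubspaceCover g) : g ∉ coveringBounds K := by
  rintro ⟨-, h⟩
  have h4 : 2 ^ 2 ≤ 2 ^ n := Nat.pow_le_pow_right (by norm_num) hn
  have hne : A.Nonempty := Finset.card_pos.1 (by nlinarith)
  refine hcov (hasSubspaceCover_of_isCoveredByTranslates (h m hm A hne ?_))
  rw [addConst_le_iff hne]
  have h1 : (A.card : ℝ) + 1 = d * 2 ^ n := by exact_mod_cast hA
  have h2 : ((A + A).card : ℝ) ≤ c * 2 ^ n := by exact_mod_cast hAA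
  rw [← h1, add_sub_cancel_right] at hK
  exact h2.trans hK

/-- All nonzero vectors: one translate of a subspace that is not larger misses many of them. -/
theorem one_notMem_coveringBounds {K : ℝ} (hK : 1 < K) : 1 ∉ coveringBounds K := by
  obtain ⟨n, hn, h⟩ := exists_two_pow_bound (K := K) (c := 1) (d := 1) (by simpa using hK)
  have hcard : Fintype.card (Fin n → ZMod 2) = 2 ^ n := by
    rw [Fintype.card_fun, ZMod.card, Fintype.card_fin]
  have h4 : 2 ^ 2 ≤ 2 ^ n := Nat.pow_le_pow_right (by norm_num) hn
  have hA : ((Finset.univ : Finset (Fin n → ZMod 2)).erase 0).card + 1 = 2 ^ n := by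
    rw [Finset.card_erase_add_one (Finset.mem_univ _), Finset.card_univ, hcard]
  refine notMem_coveringBounds (m := n) (by omega) one_pos hn h (by rwa [one_mul]) ?_ ?_
  · rw [one_mul, ← hcard]
    exact Finset.card_le_univ _
  · rintro ⟨V, hV, hcov⟩
    have htop : (⊤ : Submodule (ZMod 2) (Fin n → ZMod 2)).points = Finset.univ := by ext y; simp
    obtain ⟨r, hr⟩ := Submodule.card_points_eq_two_pow_mul (le_top : V ≤ ⊤)
    rw [htop, Finset.card_univ, hcard] at hr
    have hAV := hcov.trans' (Finset.card_le_card (fun a ha =>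
      Finset.mem_add.2 ⟨a, ha, 0, by simp, add_zero a⟩ :
        (Finset.univ : Finset (Fin n → ZMod 2)).erase 0 ⊆ _))
    rcases r with _ | r
    · omega
    · have : 1 ≤ 2 ^ r := Nat.one_le_two_pow
      rw [pow_succ 2 r] at hr
      have : 2 * V.points.card ≤ 2 ^ r * 2 * V.points.card := by nlinarith
      omega

theorem two_notMem_coveringBounds {K : ℝ} (hK : 7 / 4 < K) : 2 ∉ coveringBounds K := by
  obtain ⟨n, hn, h⟩ := exists_two_pow_bound (K := K) (c := 7) (d := 4) (by push_cast; linarith)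
  have h1 := two_mul_card_puncturedZeros_cylinder (n := n) (by simp [rankTwoQuadric])
    rankTwoQuadric_add
  have h2 := card_add_puncturedZeros_cylinder_le (n := n) rankTwoQuadric_add
  rw [pow_add] at h1 h2
  exact notMem_coveringBounds (by omega) (by norm_num) hn h (by omega) (by omega)
    (not_hasSubspaceCover_two hn)

theorem three_notMem_coveringBounds {K : ℝ} (hK : 31 / 16 < K) : 3 ∉ coveringBounds K := by
  obtain ⟨n, hn, h⟩ := exists_two_pow_bound (K := K) (c := 31) (d := 16)
    (by push_cast; linarith)
  have h1 := two_mul_card_puncturedZeros_cylinder (n := n) (by simp [rankFourQuadric])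
    rankFourQuadric_add
  have h2 := card_add_puncturedZeros_cylinder_le (n := n) rankFourQuadric_add
  rw [pow_add] at h1 h2
  exact notMem_coveringBounds (by omega) (by norm_num) hn h (by omega) (by omega)
    (not_hasSubspaceCover_three (n := n))

theorem coveringBounds_mono {K : ℝ} {g g' : ℕ} (h : g ∈ coveringBounds K) (hg : g ≤ g') :
    g' ∈ coveringBounds K := by
  refine ⟨h.1.trans_le hg, fun m hm A hA hK => ?_⟩
  obtain ⟨V, hV, T, hT, hAT⟩ := h.2 m hm A hA hK
  exact ⟨V, hV, T, hT.trans hg, hAT⟩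

theorem G_eq_succ {K : ℝ} {g : ℕ} (h : g + 1 ∈ coveringBounds K) (h' : g ∉ coveringBounds K) :
    G K = g + 1 := by
  refine le_antisymm (Nat.sInf_le h) ?_
  by_contra! hlt
  exact h' (coveringBounds_mono (Nat.sInf_mem ⟨_, h⟩) (Nat.lt_succ_iff.1 hlt))

theorem mem_coveringBounds {K : ℝ} (hK2 : K < 2) :
    4 ∈ coveringBounds K ∧ (K ≤ 31 / 16 → 3 ∈ coveringBounds K) ∧
      (K ≤ 7 / 4 → 2 ∈ coveringBounds K) := by
  have key : ∀ m : ℕ, ∀ A : Finset (Fin m → ZMod 2), A.Nonempty →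
      ((A.addConst A : ℚ≥0) : ℝ) ≤ K → A.HasSubspaceCover 4 ∧
        (K ≤ 31 / 16 → A.HasSubspaceCover 3) ∧ (K ≤ 7 / 4 → A.HasSubspaceCover 2) := by
    intro m A hne hA
    rw [addConst_le_iff hne] at hA
    have hpos : (0 : ℝ) < A.card := by exact_mod_cast hne.card_pos
    have hlt : (A + A).card < 2 * A.card := by
      have : ((A + A).card : ℝ) < 2 * A.card := by nlinarith
      exact_mod_cast this
    obtain ⟨h4, h3, h2⟩ := Finset.hasSubspaceCover_of_card_add_self_lt hne hlt
    refine ⟨h4, fun hK => h3 ?_, fun hK => h2 ?_⟩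
    · have : (16 * (A + A).card : ℝ) ≤ 31 * A.card := by nlinarith
      exact_mod_cast this
    · have : (4 * (A + A).card : ℝ) ≤ 7 * A.card := by nlinarith
      exact_mod_cast this
  refine ⟨⟨by norm_num, fun m _ A hne hA => ?_⟩, fun hK => ⟨by norm_num, fun m _ A hne hA => ?_⟩,
    fun hK => ⟨by norm_num, fun m _ A hne hA => ?_⟩⟩
  · exact isCoveredByTranslates_of_hasSubspaceCover (key m A hne hA).1
  · exact isCoveredByTranslates_of_hasSubspaceCover ((key m A hne hA).2.1 hK)
  · exact isCoveredByTranslates_of_hasSubspaceCover ((key m A hne hA).2.2 hK)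

theorem theorem1p9 (K : ℝ) :
    (1 < K → K ≤ 7 / 4 → G K = 2) ∧
    (7 / 4 < K → K ≤ 31 / 16 → G K = 3) ∧
    (31 / 16 < K → K < 2 → G K = 4) :=
  ⟨fun h1 h2 => G_eq_succ ((mem_coveringBounds (by linarith)).2.2 h2)
      (one_notMem_coveringBounds h1),
    fun h1 h2 => G_eq_succ ((mem_coveringBounds (by linarith)).2.1 h2)
      (two_notMem_coveringBounds h1),
    fun h1 h2 => G_eq_succ (mem_coveringBounds h2).1 (three_notMem_coveringBounds h1)⟩
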